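/- Let $s>1$ and $0<i<s$ be integers with $\gcd(i,s)=1$, let $q=3^s$, and let $h=\frac{q-3^i}{2}$ or $h=\frac{3^i-1}{2}$. Let $m$ be the multiplicative order of $q$ modulo $q+1$ and let $\beta\in\mathbb{F}_{q^m}$ be a primitive $(q+1)$-th root of unity. Let $\mathcal{C}_{(q,q+1,3,h)}$ be the BCH code of length $q+1$ over $\mathbb{F}_q$ with designed distance $3$ and offset $h$, that is, the set of words $(c_0,\dots,c_q)\in\mathbb{F}_q^{q+1}$ such that the class of $c_0+c_1x+\cdots+c_qx^q$ lies in the ideal of $\mathbb{F}_q[x]/(x^{q+1}-1)$ generated by $\mathrm{lcm}\left(M_{\beta^h}(x),M_{\beta^{h+1}}(x)\right)$, where $M_\gamma(x)$ is the minimal polynomial of $\gamma$ over $\mathbb{F}_q$. An $[n,k,d]$ code over $\mathbb{F}_q$ is a $k$-dimensional subspace of $\mathbb{F}_q^n$ whose nonzero elements have minimum Hamming weight $d$. The dual of $\mathcal{C}$ is $\mathcal{C}^\perp=\{v\in\mathbb{F}_q^n: c\cdot v=0\text{ for all }c\in\mathcal{C}\}$. A code is almost MDS (AMDS) if it is an $[n,k,n-k]$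 code for some $n,k$, and near MDS (NMDS) if both it and its dual are AMDS. Then $\mathcal{C}_{(q,q+1,3,h)}$ is an NMDS code with parameters $[q+1,q-3,4]$, and its dual code $\mathcal{C}^\perp_{(q,q+1,3,h)}$ has parameters $[q+1,4,q-3]$. -/

import Mathlib

open Polynomial

/-- The dual code `C^⊥ = {v ∈ F^n : c · v = 0 for all c ∈ C}`. -/
def dualCode {F ι : Type*} [Field F] [Fintype ι] (C : Submodule F (ι → F)) :
    Submodule F (ι → F) where
  carrier := {v | ∀ c ∈ C, c ⬝ᵥ v = 0}
  zero_mem' := fun c _ => dotProduct_zero c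
  add_mem' := fun {v w} hv hw c hc => by rw [dotProduct_add, hv c hc, hw c hc, add_zero]
  smul_mem' := fun a v hv c hc => by rw [dotProduct_smul, hv c hc, smul_zero]

open Classical in
/-- The linear code `C` is an `[n, k, d]` code: it has length `n`, dimension `k`, and `d` is the
smallest Hamming weight of a nonzero codeword (in particular there is a nonzero codeword). -/
def HasCodeParameters {F ι : Type*} [Field F] [Fintype ι] (C : Submodule F (ι → F))
    (n k d : ℕ) : Prop :=
  Fintype.card ι = n ∧ Module.finrank F C = k ∧
    IsLeast {w : ℕ | ∃ c ∈ C, c ≠ 0 ∧ hammingNorm c = w} d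

/-- Almost MDS: an `[n, k, n - k]` code. -/
def IsAMDS {F ι : Type*} [Field F] [Fintype ι] (C : Submodule F (ι → F)) : Prop :=
  ∃ n k : ℕ, k ≤ n ∧ HasCodeParameters C n k (n - k)

/-- Near MDS: both the code and its dual are almost MDS. -/
def IsNMDS {F ι : Type*} [Field F] [Fintype ι] (C : Submodule F (ι → F)) : Prop :=
  IsAMDS C ∧ IsAMDS (dualCode C)

/-- The linear map `(c_0, …, c_{n-1}) ↦ c_0 + c_1 x + ⋯ + c_{n-1} x^{n-1}` from `F^n` to
`F[x] / (x^n - 1)`. -/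
noncomputable def wordClass (F : Type*) [Field F] (n : ℕ) :
    (Fin n → F) →ₗ[F] F[X] ⧸ Ideal.span {(X ^ n - 1 : F[X])} :=
  (Ideal.Quotient.mkₐ F (Ideal.span {(X ^ n - 1 : F[X])})).toLinearMap ∘ₗ
    ∑ i : Fin n, (Polynomial.monomial (i : ℕ)) ∘ₗ LinearMap.proj i

/-- The cyclic code of length `n` over `F` generated by the polynomial `g`: the words whose class
lies in the ideal of `F[x] / (x^n - 1)` generated by `g`. -/
noncomputable def cyclicCode (F : Type*) [Field F] (n : ℕ) (g : F[X]) :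
    Submodule F (Fin n → F) :=
  ((Ideal.span {Ideal.Quotient.mk (Ideal.span {(X ^ n - 1 : F[X])}) g}).restrictScalars F).comap
    (wordClass F n)

open Classical in
/-- The (monic) polynomial `lcm (M_{β^h}, M_{β^{h+1}}, …, M_{β^{h+δ-2}})` over `F`, where `M_γ` is
the minimal polynomial of `γ` over `F`. -/
noncomputable def bchGenerator (F : Type*) {E : Type*} [Field F] [Field E] [Algebra F E]
    (β : E) (δ h : ℕ) : F[X] :=
  letI : NormalizedGCDMonoid F[X] := UniqueFactorizationMonoid.toNormalizedGCDMonoid F[X]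
  (Finset.range (δ - 1)).lcm fun j => minpoly F (β ^ (h + j))

/-- The BCH code of length `n` over `F` with designed distance `δ` and offset `h`, with respect to
the primitive `n`-th root of unity `β` in the extension field `E` of `F`. -/
noncomputable def bchCode (F : Type*) {E : Type*} [Field F] [Field E] [Algebra F E]
    (n δ h : ℕ) (β : E) : Submodule F (Fin n → F) :=
  cyclicCode F n (bchGenerator F β δ h)

/-! Put `P = 3 ^ i = 2 * e + 1` and let `x j` run over the `(q+1)`-th roots of unity, where `x ^ q =
x⁻¹`. Up to signs on the coordinates, a codeword has zeros `x ^ e` and `x ^ (e + 1)`. Together with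
their `q`-th powers, and after rescaling by `x ^ (-(e + 1))`, these say that the points `(1, x, x ^
P, x ^ (P + 1))` satisfy a linear relation. Testing a relation against `(X - a) * (X - b) ^ P` shows
that three points are independent, and that four dependent points have a cross-ratio `t` with `t ^ P
= t`. Also `t ^ q = t` on the unit circle, so `gcd(i, s) = 1` puts `t` in the prime field; as `t ≠
0, 1`, the quadruple is harmonic (`IsRelation.cross_add_cross_eq_zero`). Three points determine the
fourth, so no five coordinates carry a two-dimensional subcode. With a word on an actual harmonic
quadruple and codimension at most four, `hasCodeParameters_of_codim_four` gives both sets of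
parameters. -/

/-! ### Linear codes: duality and subcodes with prescribed support. -/

section LinearCodes

variable {F ι : Type*} [Field F]

/-- The words supported on `S`. -/
def supportedOn (F : Type*) [Field F] {ι : Type*} (S : Finset ι) : Submodule F (ι → F) :=
  ⨅ i ∈ ((S : Set ι)ᶜ), LinearMap.ker (LinearMap.proj i : (ι → F) →ₗ[F] F)

theorem mem_supportedOn {S : Finset ι} {c : ι → F} :
    c ∈ supportedOn F S ↔ ∀ i, i ∉ S → c i = 0 := by
  simp [supportedOn]

theorem finrank_supportedOn (S : Finset ι) : Module.finrank F (supportedOn F S) = S.card := by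
  classical
  rw [supportedOn, (LinearMap.iInfKerProjEquiv F (fun _ : ι => F) (I := (S : Set ι))
    (J := (S : Set ι)ᶜ) disjoint_compl_right (by simp)).finrank_eq]
  simp

variable [Fintype ι]

theorem mem_dualCode {C : Submodule F (ι → F)} {v : ι → F} :
    v ∈ dualCode C ↔ ∀ c ∈ C, c ⬝ᵥ v = 0 := Iff.rfl

theorem finrank_add_finrank_dualCode (C : Submodule F (ι → F)) :
    Module.finrank F C + Module.finrank F (dualCode C) = Fintype.card ι := by
  classical
  have h : dualCode C = C.dualAnnihilator.comap (dotProductEquiv F ι).toLinearMap := by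
    ext v
    simp [mem_dualCode, Submodule.mem_dualAnnihilator, dotProduct_comm v]
  have h2 := Subspace.finrank_add_finrank_dualAnnihilator_eq C
  rw [h, Submodule.comap_equiv_eq_map_symm, LinearEquiv.finrank_map_eq, h2, Module.finrank_pi]

theorem mem_dualCode_supportedOn {S : Finset ι} {v : ι → F} :
    v ∈ dualCode (supportedOn F S) ↔ ∀ i ∈ S, v i = 0 := by
  classical
  refine ⟨fun h i hi => ?_, fun h c hc => Finset.sum_eq_zero fun i _ => ?_⟩
  · have := h (Pi.single i 1) (mem_supportedOn.2 fun j hj => ?_)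
    · simpa using this
    · rw [Pi.single_eq_of_ne]; rintro rfl; exact hj hi
  · by_cases hi : i ∈ S
    · simp [h i hi]
    · simp [mem_supportedOn.1 hc i hi]

theorem dualCode_sup (C D : Submodule F (ι → F)) :
    dualCode (C ⊔ D) = dualCode C ⊓ dualCode D := by
  ext v
  refine ⟨fun h => ⟨fun c hc => h c (Submodule.mem_sup_left hc),
    fun c hc => h c (Submodule.mem_sup_right hc)⟩, fun h c hc => ?_⟩
  obtain ⟨a, ha, b, hb, rfl⟩ := Submodule.mem_sup.1 hc
  rw [add_dotProduct, h.1 a ha, h.2 b hb, add_zero]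

/-- The dimension of the space of dual codewords vanishing on `S`. -/
theorem finrank_add_card_add_finrank_dualCode_inf (C : Submodule F (ι → F)) (S : Finset ι) :
    Module.finrank F C + S.card +
      Module.finrank F (dualCode C ⊓ dualCode (supportedOn F S) : Submodule F (ι → F)) =
    Fintype.card ι + Module.finrank F (C ⊓ supportedOn F S : Submodule F (ι → F)) := by
  have h1 := Submodule.finrank_sup_add_finrank_inf_eq C (supportedOn F S)
  have h2 := finrank_add_finrank_dualCode (C ⊔ supportedOn F S)
  rw [dualCode_sup] at h2
  rw [finrank_supportedOn] at h1
  omega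

open Classical in
theorem hammingNorm_le_card_of_mem_supportedOn {S : Finset ι} {c : ι → F}
    (hc : c ∈ supportedOn F S) : hammingNorm c ≤ S.card := by
  refine Finset.card_le_card fun i hi => ?_
  by_contra h
  exact (Finset.mem_filter.1 hi).2 (mem_supportedOn.1 hc i h)

open Classical in
theorem exists_mem_supportedOn {c : ι → F} {k : ℕ} (hc : hammingNorm c ≤ k)
    (hk : k ≤ Fintype.card ι) : ∃ S : Finset ι, S.card = k ∧ c ∈ supportedOn F S := by
  obtain ⟨S, h1, h2⟩ := Finset.exists_superset_card_eq
    (s := Finset.univ.filter fun i => c i ≠ 0) hc hk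
  refine ⟨S, h2, mem_supportedOn.2 fun i hi => ?_⟩
  by_contra h
  exact hi (h1 (by simpa using h))

open Classical in
theorem exists_mem_dualCode_supportedOn {v : ι → F} {k : ℕ}
    (hv : hammingNorm v + k ≤ Fintype.card ι) :
    ∃ S : Finset ι, S.card = k ∧ v ∈ dualCode (supportedOn F S) := by
  have h := Finset.card_filter_add_card_filter_not (s := (Finset.univ : Finset ι))
    (fun i => v i ≠ 0)
  obtain ⟨S, h1, h2⟩ := Finset.exists_subset_card_eq
    (s := Finset.univ.filter fun i => ¬ v i ≠ 0) (n := k)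
    (by unfold hammingNorm at hv; rw [Finset.card_univ] at h; omega)
  refine ⟨S, h2, mem_dualCode_supportedOn.2 fun i hi => ?_⟩
  simpa using h1 hi

open Classical in
theorem hammingNorm_add_card_le {S : Finset ι} {v : ι → F}
    (hv : v ∈ dualCode (supportedOn F S)) : hammingNorm v + S.card ≤ Fintype.card ι := by
  rw [hammingNorm, ← Finset.card_union_of_disjoint]
  · exact Finset.card_le_univ _
  · refine Finset.disjoint_left.2 fun i hi hS => ?_
    exact (Finset.mem_filter.1 hi).2 (mem_dualCode_supportedOn.1 hv i hS)

/-- A code of codimension at most four, of minimum distance four, for which no five coordinates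
support a two-dimensional subcode, has the parameters of a near MDS code. -/
theorem hasCodeParameters_of_codim_four {C : Submodule F (ι → F)}
    (hn : 5 ≤ Fintype.card ι) (hdim : Fintype.card ι ≤ Module.finrank F C + 4)
    (h3 : ∀ S : Finset ι, S.card = 3 → ∀ c ∈ C, c ∈ supportedOn F S → c = 0)
    (h4 : ∃ S : Finset ι, S.card = 4 ∧ ∃ c ∈ C, c ≠ 0 ∧ c ∈ supportedOn F S)
    (h5 : ∀ S : Finset ι, S.card = 5 →
      Module.finrank F (C ⊓ supportedOn F S : Submodule F (ι → F)) ≤ 1) :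
    HasCodeParameters C (Fintype.card ι) (Fintype.card ι - 4) 4 ∧
      HasCodeParameters (dualCode C) (Fintype.card ι) 4 (Fintype.card ι - 4) := by
  classical
  have hC : Module.finrank F C = Fintype.card ι - 4 := by
    -- Any five coordinates give the upper bound `dim C + 5 ≤ n + 1`.
    obtain ⟨S, hS⟩ := Finset.exists_subset_card_eq
      (s := (Finset.univ : Finset ι)) (n := 5) (by simpa using hn)
    have := finrank_add_card_add_finrank_dualCode_inf C S
    have := h5 S hS.2
    omega
  have hD := finrank_add_finrank_dualCode C
  have hlow : ∀ v ∈ dualCode C, v ≠ 0 → Fintype.card ι - 4 ≤ hammingNorm v := by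
    intro v hv hv0
    by_contra hlt
    -- Weight below `n - 4` means five zeros, but the dual words vanishing on five coordinates have
    -- dimension `dim (C ⊓ supportedOn F S) - 1 ≤ 0`.
    obtain ⟨S, hS, hvS⟩ := exists_mem_dualCode_supportedOn (v := v) (k := 5) (by omega)
    have h1 := finrank_add_card_add_finrank_dualCode_inf C S
    have h2 := h5 S hS
    have h3 : Module.finrank F
        (dualCode C ⊓ dualCode (supportedOn F S) : Submodule F (ι → F)) = 0 := by omega
    rw [Submodule.finrank_eq_zero] at h3
    exact hv0 ((Submodule.mem_bot F).1 (h3 ▸ ⟨hv, hvS⟩))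
  have hlow' : ∀ c ∈ C, c ≠ 0 → 4 ≤ hammingNorm c := by
    intro c hc hc0
    by_contra hlt
    obtain ⟨S, hS, hcS⟩ := exists_mem_supportedOn (c := c) (k := 3) (by omega) (by omega)
    exact hc0 (h3 S hS c hc hcS)
  obtain ⟨S, hS, c, hc, hc0, hcS⟩ := h4
  refine ⟨⟨rfl, hC, ⟨c, hc, hc0, ?_⟩, ?_⟩, ⟨rfl, by omega, ?_, ?_⟩⟩
  · have := hammingNorm_le_card_of_mem_supportedOn hcS
    have := hlow' c hc hc0
    convert! le_antisymm (hS ▸ this) _ <;> omega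
  · rintro _ ⟨c, hc, hc0, rfl⟩
    convert! hlow' c hc hc0
  -- For four coordinates the two dimensions agree, so the support of a weight-four word yields a
  -- dual word of weight `n - 4`.
  · have h1 := finrank_add_card_add_finrank_dualCode_inf C S
    have h2 : 0 < Module.finrank F (C ⊓ supportedOn F S : Submodule F (ι → F)) := by
      rw [Nat.pos_iff_ne_zero, Ne, Submodule.finrank_eq_zero, Submodule.eq_bot_iff]
      exact fun h => hc0 (h c ⟨hc, hcS⟩)
    have h3 : Module.finrank F
        (dualCode C ⊓ dualCode (supportedOn F S) : Submodule F (ι → F)) ≠ 0 := by omega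
    rw [Ne, Submodule.finrank_eq_zero, Submodule.eq_bot_iff] at h3
    push Not at h3
    obtain ⟨v, hv, hv0⟩ := h3
    refine ⟨v, hv.1, hv0, ?_⟩
    have h4 := hlow v hv.1 hv0
    have h5 := hammingNorm_add_card_le hv.2
    convert! (show hammingNorm v = Fintype.card ι - 4 by omega)
  · rintro _ ⟨v, hv, hv0, rfl⟩
    convert! hlow v hv hv0

end LinearCodes

/-! ### Relations among the points `(1, x, x ^ P, x ^ (P + 1))` and cross-ratios. -/

section TwistedCubic

theorem sub_pow_three_pow {E : Type*} [Field E] [CharP E 3] (a b : E) (i : ℕ) :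
    (a - b) ^ 3 ^ i = a ^ 3 ^ i - b ^ 3 ^ i :=
  haveI : Fact (Nat.Prime 3) := ⟨Nat.prime_three⟩
  sub_pow_char_pow a b i

/-- Periods of a point under cubing are closed under gcd. -/
theorem pow_three_eq_self {E : Type*} [Field E] {i s : ℕ} (h : Nat.gcd i s = 1) {t : E}
    (hi : t ^ 3 ^ i = t) (hs : t ^ 3 ^ s = t) : t ^ 3 = t := by
  have key : ∀ k : ℕ, t ^ 3 ^ k = t → Function.IsPeriodicPt (fun x : E => x ^ 3) k t := by
    intro k hk
    rw [Function.IsPeriodicPt, Function.IsFixedPt, pow_iterate]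
    exact hk
  have := (key i hi).gcd (key s hs)
  rw [h] at this
  simpa [Function.IsPeriodicPt, Function.IsFixedPt] using this

theorem cross_eq_iff {E : Type*} [Field E] {a b e f : E} (hab : a ≠ b) :
    (e - a) * (f - b) = (e - b) * (f - a) ↔ e = f := by
  rw [← sub_eq_zero, show (e - a) * (f - b) - (e - b) * (f - a) = (a - b) * (e - f) by ring,
    mul_eq_zero, sub_eq_zero, sub_eq_zero]
  simp [hab]

/-- A linear relation with coefficients `d` among the points `(1, x, x ^ P, x ^ (P + 1))`. -/
structure IsRelation {ι E : Type*} [Fintype ι] [Field E] (P : ℕ) (x d : ι → E) : Prop where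
  sum_one : ∑ j, d j = 0
  sum_self : ∑ j, d j * x j = 0
  sum_pow : ∑ j, d j * x j ^ P = 0
  sum_pow_succ : ∑ j, d j * x j ^ (P + 1) = 0

variable {ι E : Type*} [Fintype ι] [Field E]

/-- With `α = a` and `γ = b ^ P` the test function vanishes at the two points `a` and `b`. -/
theorem IsRelation.sum_mul_sub_mul_sub {P : ℕ} {x d : ι → E} (h : IsRelation P x d) (α γ : E) :
    ∑ j, d j * ((x j - α) * (x j ^ P - γ)) = 0 := by
  have : ∀ j, d j * ((x j - α) * (x j ^ P - γ)) =
      d j * x j ^ (P + 1) - γ * (d j * x j) - α * (d j * x j ^ P) + α * γ * d j := by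
    intro j; ring
  simp_rw [this]
  rw [Finset.sum_add_distrib, Finset.sum_sub_distrib, Finset.sum_sub_distrib,
    ← Finset.mul_sum, ← Finset.mul_sum, ← Finset.mul_sum, h.sum_one, h.sum_self, h.sum_pow,
    h.sum_pow_succ]
  simp

variable [CharP E 3]

theorem IsRelation.eq_zero_of_card_eq_three {i : ℕ} {x d : ι → E} (hx : Function.Injective x)
    (h : IsRelation (3 ^ i) x d) {S : Finset ι} (hS : S.card = 3) (hd : ∀ j, j ∉ S → d j = 0) :
    d = 0 := by
  classical
  funext j
  by_cases hj : j ∈ S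
  swap
  · exact hd j hj
  obtain ⟨a, b, -, hab⟩ := Finset.card_eq_two.1 (show (S.erase j).card = 2 by
    rw [Finset.card_erase_of_mem hj, hS])
  have hja : j ≠ a := by
    have : a ∈ S.erase j := by simp [hab]
    exact (Finset.ne_of_mem_erase this).symm
  have hjb : j ≠ b := by
    have : b ∈ S.erase j := by simp [hab]
    exact (Finset.ne_of_mem_erase this).symm
  have h1 := h.sum_mul_sub_mul_sub (x a) (x b ^ 3 ^ i)
  rw [Finset.sum_eq_single j, ← sub_pow_three_pow] at h1
  · have h2 : x j - x a ≠ 0 := sub_ne_zero.2 (hx.ne hja)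
    have h3 : (x j - x b) ^ 3 ^ i ≠ 0 := pow_ne_zero _ (sub_ne_zero.2 (hx.ne hjb))
    simpa [h2, h3] using h1
  · intro k _ hk
    by_cases hkS : k ∈ S
    · have : k ∈ S.erase j := Finset.mem_erase.2 ⟨hk, hkS⟩
      rw [hab, Finset.mem_insert, Finset.mem_singleton] at this
      rcases this with rfl | rfl <;> simp
    · simp [hd k hkS]
  · simp

theorem IsRelation.cross_add_cross_eq_zero {i s : ℕ} (his : Nat.gcd i s = 1) {x d : ι → E}
    (hx : Function.Injective x) (hxq : ∀ j, x j ^ (3 ^ s + 1) = 1)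
    (h : IsRelation (3 ^ i) x d) {a b e f : ι} (hab : a ≠ b) (hae : a ≠ e) (haf : a ≠ f)
    (hbe : b ≠ e) (hbf : b ≠ f) (hef : e ≠ f)
    (hd : ∀ j, j ≠ a → j ≠ b → j ≠ e → j ≠ f → d j = 0) (hd0 : d ≠ 0) :
    (x e - x a) * (x f - x b) + (x e - x b) * (x f - x a) = 0 := by
  classical
  have hsum : ∀ g : ι → E, ∑ j, d j * g j = d a * g a + d b * g b + d e * g e + d f * g f := by
    intro g
    rw [← Finset.sum_subset (Finset.subset_univ ({a, b, e, f} : Finset ι))]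
    · rw [Finset.sum_insert (by simp [hab, hae, haf]), Finset.sum_insert (by simp [hbe, hbf]),
        Finset.sum_insert (by simp [hef]), Finset.sum_singleton]
      ring
    · intro j _ hj
      simp only [Finset.mem_insert, Finset.mem_singleton, not_or] at hj
      rw [hd j hj.1 hj.2.1 hj.2.2.1 hj.2.2.2, zero_mul]
  have hde : d e ≠ 0 := by
    intro h0
    refine hd0 (h.eq_zero_of_card_eq_three hx (S := {a, b, f})
      (Finset.card_eq_three.2 ⟨a, b, f, hab, haf, hbf, rfl⟩) fun j hj => ?_)
    simp only [Finset.mem_insert, Finset.mem_singleton, not_or] at hj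
    rcases eq_or_ne j e with rfl | hje
    · exact h0
    · exact hd j hj.1 hj.2.1 hje hj.2.2
  -- Both test functions kill the terms at `a` and `b`; eliminating `d f` and cancelling `d e` gives
  -- `hmain`.
  have e1 := h.sum_mul_sub_mul_sub (x a) (x b ^ 3 ^ i)
  have e2 := h.sum_mul_sub_mul_sub (x b) (x a ^ 3 ^ i)
  rw [hsum] at e1 e2
  simp only [← sub_pow_three_pow, sub_self, zero_mul, mul_zero, zero_add] at e1 e2
  have hea : x e - x a ≠ 0 := sub_ne_zero.2 (hx.ne hae.symm)
  have heb : x e - x b ≠ 0 := sub_ne_zero.2 (hx.ne hbe.symm)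
  have hfa : x f - x a ≠ 0 := sub_ne_zero.2 (hx.ne haf.symm)
  have hfb : x f - x b ≠ 0 := sub_ne_zero.2 (hx.ne hbf.symm)
  have hmain : (x e - x a) * (x f - x b) * ((x e - x b) * (x f - x a)) ^ 3 ^ i =
      (x e - x b) * (x f - x a) * ((x e - x a) * (x f - x b)) ^ 3 ^ i := by
    rw [mul_pow, mul_pow]
    refine mul_left_cancel₀ hde ?_
    linear_combination (x f - x b) * (x f - x a) ^ 3 ^ i * e1 -
      (x f - x a) * (x f - x b) ^ 3 ^ i * e2
  set u := (x e - x a) * (x f - x b) with hu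
  set v := (x e - x b) * (x f - x a) with hv
  have hu0 : u ≠ 0 := mul_ne_zero hea hfb
  have hv0 : v ≠ 0 := mul_ne_zero heb hfa
  have ht1 : (u / v) ^ 3 ^ i = u / v := by
    rw [div_pow, div_eq_div_iff (pow_ne_zero _ hv0) hv0, mul_comm, ← hmain]
  have hx0 : ∀ j, x j ≠ 0 := fun j h0 => by simpa [h0] using hxq j
  have hinv : ∀ j, x j ^ 3 ^ s = (x j)⁻¹ := fun j => by
    rw [← mul_eq_one_iff_eq_inv₀ (hx0 j), ← pow_succ, hxq]
  have hsub : ∀ j k, (x j - x k) ^ 3 ^ s = -((x j)⁻¹ * (x k)⁻¹) * (x j - x k) := by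
    intro j k
    rw [sub_pow_three_pow, hinv, hinv]
    have := hx0 j
    have := hx0 k
    field_simp
    ring
  -- Each of the four points occurs once in `u` and once in `v`, so the factors from `hsub` cancel.
  have ht2 : (u / v) ^ 3 ^ s = u / v := by
    rw [div_pow, div_eq_div_iff (pow_ne_zero _ hv0) hv0, hu, hv, mul_pow, mul_pow, hsub, hsub,
      hsub, hsub]
    ring
  have ht := pow_three_eq_self his ht1 ht2
  have ht0 : u / v ≠ 0 := div_ne_zero hu0 hv0
  have ht3 : u / v ≠ 1 := by
    rw [Ne, div_eq_one_iff_eq hv0, hu, hv, cross_eq_iff (hx.ne hab)]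
    exact hx.ne hef
  have ht4 : (u / v) * ((u / v - 1) * (u / v + 1)) = 0 := by linear_combination ht
  have ht5 : u / v + 1 = 0 := by
    simpa [ht0, sub_ne_zero.2 ht3] using ht4
  rwa [div_add_one hv0, div_eq_zero_iff, or_iff_left hv0] at ht5

/-- `f` and `g` would both be the harmonic conjugate of `e` with respect to `a` and `b`. -/
theorem IsRelation.false_of_five {i s : ℕ} (his : Nat.gcd i s = 1) {x d d' : ι → E}
    (hx : Function.Injective x) (hxq : ∀ j, x j ^ (3 ^ s + 1) = 1)
    (h : IsRelation (3 ^ i) x d) (h' : IsRelation (3 ^ i) x d')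
    {a b e f g : ι} (hab : a ≠ b) (hae : a ≠ e) (haf : a ≠ f)
    (hbe : b ≠ e) (hbf : b ≠ f) (hef : e ≠ f) (hag : a ≠ g) (hbg : b ≠ g) (heg : e ≠ g)
    (hfg : f ≠ g)
    (hd : ∀ j, j ≠ a → j ≠ b → j ≠ e → j ≠ f → d j = 0) (hd0 : d ≠ 0)
    (hd' : ∀ j, j ≠ a → j ≠ b → j ≠ e → j ≠ g → d' j = 0) (hd0' : d' ≠ 0) : False := by
  have h1 := h.cross_add_cross_eq_zero his hx hxq hab hae haf hbe hbf hef hd hd0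
  have h2 := h'.cross_add_cross_eq_zero his hx hxq hab hae hag hbe hbg heg hd' hd0'
  have hea : x e - x a ≠ 0 := sub_ne_zero.2 (hx.ne hae.symm)
  refine hfg (hx ((cross_eq_iff (hx.ne hab)).1 (mul_left_cancel₀ hea ?_)))
  linear_combination (x f - x a) * h2 - (x g - x a) * h1

end TwistedCubic

/-! ### BCH codewords described by their zeros. -/

section BCH

theorem mem_cyclicCode {F : Type*} [Field F] {n : ℕ} {g : F[X]} (hg : g ∣ X ^ n - 1)
    (c : Fin n → F) : c ∈ cyclicCode F n g ↔ g ∣ ∑ i : Fin n, monomial (i : ℕ) (c i) := by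
  have h1 : wordClass F n c = Ideal.Quotient.mk (Ideal.span {(X ^ n - 1 : F[X])})
      (∑ i : Fin n, monomial (i : ℕ) (c i)) := by
    simp [wordClass]
  rw [cyclicCode, Submodule.mem_comap, Submodule.restrictScalars_mem, h1,
    Ideal.mem_span_singleton]
  refine ⟨?_, map_dvd _⟩
  rintro ⟨r, hr⟩
  obtain ⟨r, rfl⟩ := Ideal.Quotient.mk_surjective r
  rw [← map_mul, Ideal.Quotient.eq, Ideal.mem_span_singleton] at hr
  exact (dvd_sub_left (dvd_mul_right g r)).1 (hg.trans hr)

theorem bchGenerator_dvd_iff {F E : Type*} [Field F] [Field E] [Algebra F E] {β : E} {δ h : ℕ}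
    {p : F[X]} :
    bchGenerator F β δ h ∣ p ↔ ∀ k < δ - 1, minpoly F (β ^ (h + k)) ∣ p := by
  classical
  let _inst : NormalizedGCDMonoid F[X] := UniqueFactorizationMonoid.toNormalizedGCDMonoid F[X]
  refine (@Finset.lcm_dvd_iff F[X] ℕ _ _inst _ _ _).trans ?_
  simp

theorem mem_bchCode {F E : Type*} [Field F] [Field E] [Algebra F E] {n : ℕ} {β : E} (hβ : β ^ n = 1) (δ h : ℕ) (c : Fin n → F) :
    c ∈ bchCode F n δ h β ↔
      ∀ k < δ - 1, ∑ j, algebraMap F E (c j) * (β ^ (j : ℕ)) ^ (h + k) = 0 := by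
  have hint : ∀ k : ℕ, (β ^ k) ^ n = 1 := fun k => by rw [pow_right_comm, hβ, one_pow]
  have hg : bchGenerator F β δ h ∣ X ^ n - 1 :=
    bchGenerator_dvd_iff.2 fun k _ => minpoly.dvd _ _ (by simp [hint])
  rw [bchCode, mem_cyclicCode hg, bchGenerator_dvd_iff]
  refine forall_congr' fun k => imp_congr_right fun _ => ?_
  rw [minpoly.dvd_iff]
  simp [aeval_monomial, pow_right_comm]

end BCH

/-! ### Descent to `F` through the `q`-th power map. -/

section FiniteFields

/-- Evaluate `X ^ q - X = ∏ y : F, (X - y)` at `a`. -/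
theorem mem_range_algebraMap_of_pow_card {F E : Type*} [Field F] [Finite F] [Field E] [Algebra F E]
    {a : E} (ha : a ^ Nat.card F = a) : ∃ y : F, algebraMap F E y = a := by
  classical
  have := Fintype.ofFinite F
  rw [Nat.card_eq_fintype_card] at ha
  have hq : 1 < Fintype.card F := Fintype.one_lt_card
  have hm : (X ^ Fintype.card F - X : F[X]).Monic :=
    monic_X_pow_sub (by simpa using hq)
  have h := prod_multiset_X_sub_C_of_monic_of_roots_card_eq hm (by
    rw [FiniteField.roots_X_pow_card_sub_X, FiniteField.X_pow_card_sub_X_natDegree_eq F hq]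
    simp)
  rw [FiniteField.roots_X_pow_card_sub_X] at h
  have h2 := congrArg (aeval a) h
  rw [map_sub, map_pow, aeval_X, ha, sub_self] at h2
  change aeval a (∏ y : F, (X - C y)) = 0 at h2
  rw [map_prod, Finset.prod_eq_zero_iff] at h2
  obtain ⟨y, -, hy⟩ := h2
  refine ⟨y, ?_⟩
  rw [map_sub, aeval_X, aeval_C, sub_eq_zero] at hy
  exact hy.symm

theorem sum_algebraMap_mul_pow_card {F E ι : Type*} [Field F] [Finite F] [Field E] [Algebra F E]
    [Fintype ι] [CharP E 3] {s : ℕ} (hF : Nat.card F = 3 ^ s) (c : ι → F) (y : ι → E) :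
    (∑ j, algebraMap F E (c j) * y j) ^ 3 ^ s = ∑ j, algebraMap F E (c j) * y j ^ 3 ^ s := by
  have : Fact (Nat.Prime 3) := ⟨Nat.prime_three⟩
  have := Fintype.ofFinite F
  rw [← iterateFrobenius_def, map_sum]
  refine Finset.sum_congr rfl fun j _ => ?_
  rw [map_mul, iterateFrobenius_def, iterateFrobenius_def, ← map_pow, ← hF,
    Nat.card_eq_fintype_card, FiniteField.pow_card]

end FiniteFields

/-! ### Codes with two consecutive zeros on the unit circle. -/

section UnitCircle

theorem pow_card_mul_self {E : Type*} [Field E] {s : ℕ} {a : E} (ha : a ^ (3 ^ s + 1) = 1) (k : ℕ) :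
    (a ^ k) ^ 3 ^ s * a ^ k = 1 := by
  rw [← pow_succ, pow_right_comm, ha, one_pow]

variable {F E ι : Type*} [Field F] [Finite F] [Field E] [Algebra F E] [CharP E 3] [Fintype ι]
  {i s e : ℕ} {x : ι → E} {u : ι → F} {C : Submodule F (ι → F)}

/-- `C` consists of the words `c` for which `u * c` has zeros `x ^ e` and `x ^ (e + 1)`. -/
def IsZerosCode (x : ι → E) (u : ι → F) (e : ℕ) (C : Submodule F (ι → F)) : Prop :=
  ∀ c, c ∈ C ↔ ∑ j, algebraMap F E (u j * c j) * x j ^ e = 0 ∧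
    ∑ j, algebraMap F E (u j * c j) * x j ^ (e + 1) = 0

/-- The relation among the points of the twisted cubic given by a codeword. -/
theorem IsZerosCode.isRelation (hC : IsZerosCode x u e C) (hF : Nat.card F = 3 ^ s)
    (he : 2 * e + 1 = 3 ^ i) (hxq : ∀ j, x j ^ (3 ^ s + 1) = 1) {c : ι → F} (hc : c ∈ C) :
    IsRelation (3 ^ i) x
      fun j => algebraMap F E (u j * c j) * (x j ^ (e + 1)) ^ 3 ^ s := by
  obtain ⟨h0, h1⟩ := (hC c).1 hc
  have hq : 3 ^ s ≠ 0 := pow_ne_zero s (three_ne_zero : (3 : ℕ) ≠ 0)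
  -- The `q`-th powers of the two equations supply the exponents `-e` and `-(e + 1)`.
  have h0' := sum_algebraMap_mul_pow_card hF (fun j => u j * c j) (fun j => x j ^ e)
  have h1' := sum_algebraMap_mul_pow_card hF (fun j => u j * c j) (fun j => x j ^ (e + 1))
  rw [h0, zero_pow hq] at h0'
  rw [h1, zero_pow hq] at h1'
  refine ⟨h1'.symm, ?_, ?_, ?_⟩
  · rw [h0']
    refine Finset.sum_congr rfl fun j _ => ?_
    have := hxq j
    rw [pow_succ (x j) e, mul_pow, mul_assoc, mul_assoc, ← pow_succ (x j), this, mul_one]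
  · rw [← h0]
    refine Finset.sum_congr rfl fun j _ => ?_
    have := pow_card_mul_self (hxq j) (e + 1)
    rw [← he, show 2 * e + 1 = (e + 1) + e by ring, pow_add (x j) (e + 1) e, mul_assoc,
      ← mul_assoc (_ ^ 3 ^ s), this, one_mul]
  · rw [← h1]
    refine Finset.sum_congr rfl fun j _ => ?_
    have := pow_card_mul_self (hxq j) (e + 1)
    rw [← he, show 2 * e + 1 + 1 = (e + 1) + (e + 1) by ring, pow_add (x j) (e + 1) (e + 1),
      mul_assoc, ← mul_assoc (_ ^ 3 ^ s), this, one_mul]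

omit [Finite F] [CharP E 3] [Fintype ι] in
theorem algebraMap_mul_pow_eq_zero_iff (hu : ∀ j, u j ≠ 0) (hxq : ∀ j, x j ^ (3 ^ s + 1) = 1)
    {c : ι → F} {j : ι} :
    algebraMap F E (u j * c j) * (x j ^ (e + 1)) ^ 3 ^ s = 0 ↔ c j = 0 := by
  have hx0 : x j ≠ 0 := fun h0 => by simpa [h0] using hxq j
  have : (x j ^ (e + 1)) ^ 3 ^ s ≠ 0 := pow_ne_zero _ (pow_ne_zero _ hx0)
  simp [this, hu j]

theorem IsZerosCode.eq_zero_of_card_eq_three (hC : IsZerosCode x u e C)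
    (hF : Nat.card F = 3 ^ s) (he : 2 * e + 1 = 3 ^ i) (hx : Function.Injective x)
    (hxq : ∀ j, x j ^ (3 ^ s + 1) = 1) (hu : ∀ j, u j ≠ 0)
    {S : Finset ι} (hS : S.card = 3) {c : ι → F} (hc : c ∈ C) (hcS : c ∈ supportedOn F S) :
    c = 0 := by
  have h := (hC.isRelation hF he hxq hc).eq_zero_of_card_eq_three hx hS fun j hj => by
    rw [algebraMap_mul_pow_eq_zero_iff hu hxq, mem_supportedOn.1 hcS j hj]
  funext j
  exact (algebraMap_mul_pow_eq_zero_iff (e := e) hu hxq).1 (congrFun h j)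

omit [Finite F] [CharP E 3] [Fintype ι] [Field E] [Algebra F E] in
theorem exists_ne_zero_apply_eq_zero [Finite ι] {V : Submodule F (ι → F)}
    (hV : 1 < Module.finrank F V) (j : ι) : ∃ c ∈ V, c ≠ 0 ∧ c j = 0 := by
  have h := LinearMap.ker_ne_bot_of_finrank_lt
    (f := (LinearMap.proj j : (ι → F) →ₗ[F] F) ∘ₗ V.subtype) (by simpa using hV)
  obtain ⟨c, hc, hc0⟩ := (Submodule.ne_bot_iff _).1 h
  exact ⟨c, c.2, by simpa using hc0, hc⟩

theorem IsZerosCode.finrank_inf_supportedOn_le_one (hC : IsZerosCode x u e C)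
    (hF : Nat.card F = 3 ^ s) (he : 2 * e + 1 = 3 ^ i) (his : Nat.gcd i s = 1)
    (hx : Function.Injective x) (hxq : ∀ j, x j ^ (3 ^ s + 1) = 1) (hu : ∀ j, u j ≠ 0)
    {S : Finset ι} (hS : S.card = 5) :
    Module.finrank F (C ⊓ supportedOn F S : Submodule F (ι → F)) ≤ 1 := by
  classical
  by_contra! hlt
  obtain ⟨f, T', hf, rfl, hT'⟩ := Finset.card_eq_succ.1 hS
  obtain ⟨g, T, hg, rfl, hT⟩ := Finset.card_eq_succ.1 hT'
  obtain ⟨a, b, k, hab, hak, hbk, rfl⟩ := Finset.card_eq_three.1 hT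
  -- Dimension two leaves room to impose a zero: the supports lie in `{a, b, k, f}` and `{a, b, k,
  -- g}`.
  obtain ⟨c, hc, hc0, hcg⟩ := exists_ne_zero_apply_eq_zero hlt g
  obtain ⟨c', hc', hc0', hcf⟩ := exists_ne_zero_apply_eq_zero hlt f
  simp only [Finset.mem_insert, Finset.mem_singleton, not_or] at hf hg
  have hne : ∀ c : ι → F, c ≠ 0 →
      (fun j => algebraMap F E (u j * c j) * (x j ^ (e + 1)) ^ 3 ^ s) ≠ 0 := fun c hc0 h =>
    hc0 (funext fun j => (algebraMap_mul_pow_eq_zero_iff (e := e) hu hxq).1 (congrFun h j))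
  refine (hC.isRelation hF he hxq hc.1).false_of_five his hx hxq
    (hC.isRelation hF he hxq hc'.1) hab hak (Ne.symm hf.2.1) hbk (Ne.symm hf.2.2.1)
    (Ne.symm hf.2.2.2) (Ne.symm hg.1) (Ne.symm hg.2.1) (Ne.symm hg.2.2) hf.1
    (fun j h1 h2 h3 h4 => ?_) (hne c hc0) (fun j h1 h2 h3 h4 => ?_) (hne c' hc0')
  · rw [algebraMap_mul_pow_eq_zero_iff hu hxq]
    rcases eq_or_ne j g with rfl | h5
    · exact hcg
    · exact mem_supportedOn.1 hc.2 j (by simp [h1, h2, h3, h4, h5])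
  · rw [algebraMap_mul_pow_eq_zero_iff hu hxq]
    rcases eq_or_ne j f with rfl | h5
    · exact hcf
    · exact mem_supportedOn.1 hc'.2 j (by simp [h1, h2, h3, h4, h5])

omit [Finite F] [CharP E 3] in
-- `C` is the kernel of an `F`-linear map into `E × E`, which has dimension four.
theorem IsZerosCode.card_le_finrank_add_four (hC : IsZerosCode x u e C)
    (hE : Module.finrank F E = 2) : Fintype.card ι ≤ Module.finrank F C + 4 := by
  have : Module.Finite F E := Module.finite_of_finrank_pos (by omega)
  let φ : ℕ → (ι → F) →ₗ[F] E := fun k =>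
    ∑ j, (LinearMap.proj j : (ι → F) →ₗ[F] F).smulRight (algebraMap F E (u j) * x j ^ k)
  have hφ : ∀ k c, φ k c = ∑ j, algebraMap F E (u j * c j) * x j ^ k := by
    intro k c
    simp only [φ, LinearMap.sum_apply, LinearMap.smulRight_apply, LinearMap.proj_apply,
      Algebra.smul_def, map_mul]
    exact Finset.sum_congr rfl fun j _ => by ring
  have hker : LinearMap.ker ((φ e).prod (φ (e + 1))) = C := by
    ext c
    rw [LinearMap.mem_ker, LinearMap.prod_apply, Function.prod, Prod.mk_eq_zero, hφ, hφ, hC]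
  have h1 := LinearMap.finrank_range_add_finrank_ker ((φ e).prod (φ (e + 1)))
  have h2 := Submodule.finrank_le (LinearMap.range ((φ e).prod (φ (e + 1))))
  rw [Module.finrank_prod, hE] at h2
  rw [hker, Module.finrank_pi] at h1
  omega

/-- A codeword of weight four, supported on the harmonic quadruple `1, -1, z, z⁻¹`. -/
theorem IsZerosCode.exists_card_eq_four (hC : IsZerosCode x u e C)
    (hF : Nat.card F = 3 ^ s) (he : 2 * e + 1 = 3 ^ i) (hu : ∀ j, u j ≠ 0)
    {a b k l : ι} (hab : a ≠ b) (hak : a ≠ k) (hal : a ≠ l) (hbk : b ≠ k) (hbl : b ≠ l)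
    (hkl : k ≠ l) (hk : x k ^ (3 ^ s + 1) = 1) (ha : x a = 1) (hb : x b = -1)
    (hl : x l = (x k)⁻¹) :
    ∃ S : Finset ι, S.card = 4 ∧ ∃ c ∈ C, c ≠ 0 ∧ c ∈ supportedOn F S := by
  classical
  set z := x k with hz
  have hz0 : z ≠ 0 := fun h0 => by simp [h0] at hk
  have h3 : (3 : E) = 0 := CharP.cast_eq_zero E 3
  have hzq : z ^ 3 ^ s = z⁻¹ := by rw [← mul_eq_one_iff_eq_inv₀ hz0, ← pow_succ, hk]
  have hneg : (-1 : E) ^ 3 ^ s = -1 := (Odd.pow (by decide : Odd 3)).neg_one_pow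
  have hsubq : ∀ ε : E, ε ^ 3 ^ s = ε → ε * ε = 1 →
      ((z - ε) ^ 2 / z) ^ 3 ^ s = (z - ε) ^ 2 / z := by
    intro ε h1 h2
    rw [div_pow, pow_right_comm, sub_pow_three_pow, hzq, h1]
    field_simp
    linear_combination (z ^ 2 - 1) * h2
  obtain ⟨y, hy⟩ := mem_range_algebraMap_of_pow_card (F := F) (a := (z - -1) ^ 2 / z)
    (by rw [hF]; exact hsubq _ hneg (by ring))
  obtain ⟨y', hy'⟩ := mem_range_algebraMap_of_pow_card (F := F) (a := (z - 1) ^ 2 / z)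
    (by rw [hF]; exact hsubq _ (one_pow _) (by ring))
  -- After multiplication by `z ^ (e + 1)`, the coefficients at `1` and `-1` become `(z + 1) ^ (P +
  -- 1)` and `±(z - 1) ^ (P + 1)`. Expanding them in characteristic 3 leaves only multiples of 3 in
  -- both equations.
  let w : ι → F := Pi.single a (y ^ (e + 1)) + Pi.single b ((-1) ^ (e + 1) * y' ^ (e + 1)) +
    Pi.single k 1 + Pi.single l 1
  have hw : ∀ g : ι → E, ∑ j, algebraMap F E (w j) * g j =
      algebraMap F E y ^ (e + 1) * g a + (-1) ^ (e + 1) * algebraMap F E y' ^ (e + 1) * g b +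
        g k + g l := by
    intro g
    simp [w, add_mul, Finset.sum_add_distrib, Pi.single_apply, apply_ite (algebraMap F E)]
  have hwk : w k = 1 := by simp [w, hak.symm, hbk.symm, hkl]
  have hpow : ∀ ε : E, ε ^ (2 * e + 1) = ε → ε * ε = 1 →
      ((z - ε) ^ 2 / z) ^ (e + 1) * z ^ (e + 1) =
        z ^ (e + 1) * z ^ (e + 1) - ε * z - ε * z ^ (2 * e + 1) + 1 := by
    intro ε h1 h2
    rw [div_pow, div_mul_cancel₀ _ (pow_ne_zero _ hz0), ← pow_mul,
      show 2 * (e + 1) = 2 * e + 1 + 1 by ring, pow_succ, he, sub_pow_three_pow, ← he, h1]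
    linear_combination h2
  have hp := hpow (-1) (by rw [pow_succ, pow_mul]; simp) (by ring)
  have hp' := hpow 1 (one_pow _) (by ring)
  rw [← hy] at hp
  rw [← hy'] at hp'
  have hs1 : ((-1 : E) ^ (e + 1)) * (-1) ^ e = -1 := by
    rw [← pow_add, show e + 1 + e = 2 * e + 1 by ring, pow_succ, pow_mul]; simp
  have hs2 : ((-1 : E) ^ (e + 1)) * (-1) ^ (e + 1) = 1 := by
    rw [← pow_add, ← two_mul, pow_mul]; simp
  have hinv : z ^ (e + 1) * z⁻¹ ^ (e + 1) = 1 := by rw [← mul_pow, mul_inv_cancel₀ hz0, one_pow]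
  have hinv' : z ^ (e + 1) * z⁻¹ ^ e = z := by
    rw [pow_succ, mul_right_comm, ← mul_pow, mul_inv_cancel₀ hz0, one_pow, one_mul]
  have huw : ∀ j, u j * ((u j)⁻¹ * w j) = w j := fun j => by rw [mul_inv_cancel_left₀ (hu j)]
  refine ⟨{a, b, k, l}, ?_, fun j => (u j)⁻¹ * w j, (hC _).2 ⟨?_, ?_⟩, ?_, ?_⟩
  · rw [Finset.card_insert_of_notMem (by simp [hab, hak, hal]),
      Finset.card_eq_three.2 ⟨b, k, l, hbk, hbl, hkl, rfl⟩]
  · simp_rw [huw]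
    refine mul_left_cancel₀ (pow_ne_zero (e + 1) hz0) ?_
    rw [hw, ha, hb, hl, ← hz]
    rw [show 2 * e + 1 = (e + 1) + e by ring, pow_add z (e + 1) e] at hp hp'
    linear_combination hp - hp' + algebraMap F E y' ^ (e + 1) * z ^ (e + 1) * hs1 + hinv' +
      (z ^ (e + 1) * z ^ e + z) * h3
  · simp_rw [huw]
    refine mul_left_cancel₀ (pow_ne_zero (e + 1) hz0) ?_
    rw [hw, ha, hb, hl, ← hz]
    linear_combination hp + hp' + algebraMap F E y' ^ (e + 1) * z ^ (e + 1) * hs2 + hinv +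
      (z ^ (e + 1) * z ^ (e + 1) + 1) * h3
  · intro h
    have := congrFun h k
    simp [hwk, hu k] at this
  · refine mem_supportedOn.2 fun j hj => ?_
    simp only [Finset.mem_insert, Finset.mem_singleton, not_or] at hj
    simp [w, hj.1, hj.2.1, hj.2.2.1, hj.2.2.2]

end UnitCircle

/-! ### The two offsets and the final parameters. -/

section Main

/-- `q` is `-1` modulo `q + 1`, and `-1 ≠ 1` there because `q > 1`. -/
theorem orderOf_natCast_zmod_succ {q : ℕ} (hq : 1 < q) : orderOf (q : ZMod (q + 1)) = 2 := by
  have : Fact (1 < q + 1) := ⟨by omega⟩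
  have h : (q : ZMod (q + 1)) = -1 := by
    rw [eq_neg_iff_add_eq_zero]
    exact_mod_cast ZMod.natCast_self (q + 1)
  rw [h, orderOf_neg_one, ZMod.ringChar_zmod_n, if_neg (by omega)]

theorem pow_half_eq_neg_one {E : Type*} [Field E] {β : E} {n N : ℕ} (hn : 0 < n)
    (hβ : IsPrimitiveRoot β n) (hN : 2 * N = n) : β ^ N = -1 := by
  have h1 : β ^ N ≠ 1 := hβ.pow_ne_one_of_pos_of_lt (by omega) (by omega)
  have h2 : β ^ N * β ^ N = 1 := by rw [← pow_add, ← two_mul, hN, hβ.pow_eq_one]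
  exact (mul_self_eq_one_iff.1 h2).resolve_left h1

theorem mem_bchCode_three {F E : Type*} [Field F] [Field E] [Algebra F E] {n h : ℕ} {β : E}
    (hβ : β ^ n = 1) (c : Fin n → F) :
    c ∈ bchCode F n 3 h β ↔ ∑ j, algebraMap F E (c j) * (β ^ (j : ℕ)) ^ h = 0 ∧
      ∑ j, algebraMap F E (c j) * (β ^ (j : ℕ)) ^ (h + 1) = 0 := by
  rw [mem_bchCode hβ]
  change (∀ k < 2, _) ↔ _
  simp only [Nat.forall_lt_succ_right, Nat.not_lt_zero, IsEmpty.forall_iff, implies_true,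
    true_and, add_zero]

variable {F E : Type*} [Field F] [Finite F] [Field E] [Algebra F E] [CharP E 3] {s i e : ℕ}
  {β : E}

omit [Finite F] [CharP E 3] in
theorem isZerosCode_bchCode (hβ : β ^ (3 ^ s + 1) = 1) (e : ℕ) :
    IsZerosCode (fun j : Fin (3 ^ s + 1) => β ^ (j : ℕ)) (fun _ => (1 : F)) e
      (bchCode F (3 ^ s + 1) 3 e β) := by
  intro c
  simp [mem_bchCode_three hβ]

/-- Conjugation turns exponent `k` into `-k = (N - k) - N`, and `x ^ N = (-1) ^ j` at `x = β ^ j`;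
hence the exponents `h, h + 1` become `e + 1, e` with alternating signs. -/
theorem isZerosCode_bchCode_twist (hF : Nat.card F = 3 ^ s) {N : ℕ} (hN : 2 * N = 3 ^ s + 1)
    (hβ : IsPrimitiveRoot β (3 ^ s + 1)) {h : ℕ} (he : h + (e + 1) = N) :
    IsZerosCode (fun j : Fin (3 ^ s + 1) => β ^ (j : ℕ)) (fun j => (-1 : F) ^ (j : ℕ)) e
      (bchCode F (3 ^ s + 1) 3 h β) := by
  intro c
  have hq : 3 ^ s ≠ 0 := pow_ne_zero s (three_ne_zero : (3 : ℕ) ≠ 0)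
  have hβN : β ^ N = -1 := pow_half_eq_neg_one (by omega) hβ hN
  have hβ0 : β ≠ 0 := hβ.ne_zero (by omega)
  have key : ∀ k l : ℕ, k + l = N → (∑ j : Fin (3 ^ s + 1),
      algebraMap F E (c j) * (β ^ (j : ℕ)) ^ k = 0 ↔ ∑ j : Fin (3 ^ s + 1),
      algebraMap F E ((-1) ^ (j : ℕ) * c j) * (β ^ (j : ℕ)) ^ l = 0) := by
    intro k l hkl
    rw [← pow_eq_zero_iff hq, sum_algebraMap_mul_pow_card hF]
    refine Eq.congr_left (Finset.sum_congr rfl fun j _ => ?_)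
    have h1 := pow_card_mul_self (s := s) (a := β ^ (j : ℕ))
      (by rw [pow_right_comm, hβ.pow_eq_one, one_pow]) k
    have h2 : (β ^ (j : ℕ)) ^ l * (β ^ (j : ℕ)) ^ k = (-1) ^ (j : ℕ) := by
      rw [← pow_add, add_comm l k, hkl, pow_right_comm, hβN]
    have h3 : ((-1 : E) ^ (j : ℕ)) * (-1) ^ (j : ℕ) = 1 := by rw [← mul_pow]; simp
    refine mul_right_cancel₀ (pow_ne_zero k (pow_ne_zero (j : ℕ) hβ0)) ?_
    rw [mul_assoc, h1, mul_assoc, h2]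
    simp only [map_mul, map_pow, map_neg, map_one]
    linear_combination -algebraMap F E (c j) * h3
  rw [mem_bchCode_three hβ.pow_eq_one, ← key (h + 1) e (by omega), ← key h (e + 1) he, and_comm]

theorem IsZerosCode.hasCodeParameters (hs : 1 < s) (his : Nat.gcd i s = 1)
    (hF : Nat.card F = 3 ^ s) (hE : Module.finrank F E = 2) (he : 2 * e + 1 = 3 ^ i)
    (hβ : IsPrimitiveRoot β (3 ^ s + 1)) {u : Fin (3 ^ s + 1) → F} (hu : ∀ j, u j ≠ 0)
    {C : Submodule F (Fin (3 ^ s + 1) → F)}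
    (hC : IsZerosCode (fun j : Fin (3 ^ s + 1) => β ^ (j : ℕ)) u e C) :
    HasCodeParameters C (3 ^ s + 1) (3 ^ s - 3) 4 ∧
      HasCodeParameters (dualCode C) (3 ^ s + 1) 4 (3 ^ s - 3) := by
  have hq : 9 ≤ 3 ^ s := Nat.pow_le_pow_right (n := 3) (by omega) (show 2 ≤ s from hs)
  obtain ⟨N, hN⟩ : ∃ N, 2 * N = 3 ^ s + 1 := by
    have : Odd (3 ^ s) := (by decide : Odd 3).pow
    obtain ⟨m, hm⟩ := this
    exact ⟨m + 1, by omega⟩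
  have hx : Function.Injective fun j : Fin (3 ^ s + 1) => β ^ (j : ℕ) := fun j k hjk =>
    Fin.ext (hβ.pow_inj j.2 k.2 hjk)
  have hxq : ∀ j : Fin (3 ^ s + 1), (β ^ (j : ℕ)) ^ (3 ^ s + 1) = 1 := fun j => by
    rw [pow_right_comm, hβ.pow_eq_one, one_pow]
  have hβN : β ^ N = -1 := pow_half_eq_neg_one (by omega) hβ hN
  -- The exponents `0, N, 1, q` give the points `1, -1, β, β⁻¹`.
  have h4 := hC.exists_card_eq_four hF he hu (a := ⟨0, by omega⟩) (b := ⟨N, by omega⟩)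
    (k := ⟨1, by omega⟩) (l := ⟨3 ^ s, by omega⟩) (by simp; omega) (by simp) (by simp)
    (by simp; omega) (by simp; omega) (by simp; omega) (hxq _) (by simp) hβN
    (by
      have : β ^ 3 ^ s * β = 1 := by rw [← pow_succ, hβ.pow_eq_one]
      simpa using eq_inv_of_mul_eq_one_left this)
  have := hasCodeParameters_of_codim_four (C := C) (by simp; omega)
    (hC.card_le_finrank_add_four hE)
    (fun S hS c hc hcS => hC.eq_zero_of_card_eq_three hF he hx hxq hu hS hc hcS) h4
    (fun S hS => hC.finrank_inf_supportedOn_le_one hF he his hx hxq hu hS)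
  rw [Fintype.card_fin, show 3 ^ s + 1 - 4 = 3 ^ s - 3 by omega] at this
  exact this

end Main

theorem mainTheorem7 (s i q h : ℕ) (hs : 1 < s) (hi₀ : 0 < i) (his : i < s)
    (hgcd : Nat.gcd i s = 1) (hq : q = 3 ^ s)
    (hh : h = (q - 3 ^ i) / 2 ∨ h = (3 ^ i - 1) / 2)
    (F E : Type*) [Field F] [Field E] [Algebra F E] (hF : Nat.card F = q)
    (hE : Module.finrank F E = orderOf (q : ZMod (q + 1)))
    (β : E) (hβ : IsPrimitiveRoot β (q + 1)) :
    IsNMDS (bchCode F (q + 1) 3 h β) ∧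
      HasCodeParameters (bchCode F (q + 1) 3 h β) (q + 1) (q - 3) 4 ∧
      HasCodeParameters (dualCode (bchCode F (q + 1) 3 h β)) (q + 1) 4 (q - 3) := by
  subst hq
  have hq9 : 9 ≤ 3 ^ s := Nat.pow_le_pow_right (n := 3) (by omega) (show 2 ≤ s from hs)
  have hlt : 3 ^ i < 3 ^ s := Nat.pow_lt_pow_right (by omega) his
  have : Finite F := Nat.finite_of_card_ne_zero (by omega)
  have : Fact (Nat.Prime 3) := ⟨Nat.prime_three⟩
  have := Fintype.ofFinite F
  have : CharP F 3 := charP_of_card_eq_prime_pow (Nat.card_eq_fintype_card.symm.trans hF)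
  have : CharP E 3 := charP_of_injective_algebraMap (algebraMap F E).injective 3
  rw [orderOf_natCast_zmod_succ (by omega)] at hE
  obtain ⟨e, he⟩ : Odd (3 ^ i) := (by decide : Odd 3).pow
  obtain ⟨M, hM⟩ : Odd (3 ^ s) := (by decide : Odd 3).pow
  have key : HasCodeParameters (bchCode F (3 ^ s + 1) 3 h β) (3 ^ s + 1) (3 ^ s - 3) 4 ∧
      HasCodeParameters (dualCode (bchCode F (3 ^ s + 1) 3 h β)) (3 ^ s + 1) 4 (3 ^ s - 3) := by
    rcases hh with hh | hh
    -- Here `h + (e + 1) = (q + 1) / 2 = M + 1`.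
    · exact (isZerosCode_bchCode_twist hF (N := M + 1) (e := e) (by omega) hβ
        (by omega)).hasCodeParameters hs hgcd hF hE he.symm hβ
        fun j => pow_ne_zero _ (neg_ne_zero.2 one_ne_zero)
    · obtain rfl : h = e := by omega
      exact (isZerosCode_bchCode hβ.pow_eq_one h).hasCodeParameters hs hgcd hF hE he.symm hβ
        fun _ => one_ne_zero
  refine ⟨⟨⟨3 ^ s + 1, 3 ^ s - 3, by omega, ?_⟩, ⟨3 ^ s + 1, 4, by omega, ?_⟩⟩, key⟩
  · rw [show 3 ^ s + 1 - (3 ^ s - 3) = 4 by omega]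
    exact key.1
  · rw [show 3 ^ s + 1 - 4 = 3 ^ s - 3 by omega]
    exact key.2
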